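/- Theorem (Poincaré–Birkhoff–Witt theorem for the rational Cherednik algebra). Let $W$ be a finite Coxeter group acting on its (complex, finite-dimensional) reflection representation $\mathfrak h$; that is, $W$ is a finite subgroup of $GL(\mathfrak h)$ generated by reflections (involutions fixing a hyperplane pointwise) and preserving a nondegenerate symmetric bilinear form $(\cdot,\cdot)$ on $\mathfrak h$, which we fix. Use the form to identify $\mathfrak h\cong\mathfrak h^*$, $v\mapsto (v,\cdot)$, and denote the transported form on $\mathfrak h^*$ by $(\cdot,\cdot)$ too. Let $\Sigma\subset W$ be the set of all reflections in $W$; for each $s\in\Sigma$ choose $\alpha_s\in\mathfrak h^*\setminus\{0\}$ with $\alpha_s(sv)=-\alpha_s(v)$ for all $v\in\mathfrak h$; and let $c:\Sigma\to\mathbb C$, $s\mapsto c_s$, be invariant under conjugation by $W$. Let $x_1,\dots,x_n$ be an orthonormal basis of $\mathfrak h^*$ and $y_1,\dots,y_n$ the corresponding basis of $\mathfrak h$. The rational Cherednik algebra $H_c$ is the unital associative $\mathbb C$-algebra generated by $x_1,\dots,x_n$, $y_1,\dots,y_n$ and the elements $w\in W$, with the defining relations $$[x_i,x_j]=[y_i,y_j]=0,\qquad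 [y_i,x_j]=\delta_{ij}+\sum_{s\in\Sigma}c_s\frac{(x_i,\alpha_s)(x_j,\alpha_s)}{(\alpha_s,\alpha_s)}\,s\qquad(1\le i,j\le n),$$ $$w\,x\,w^{-1}=w(x),\qquad w\,y\,w^{-1}=w(y),\qquad w\cdot w'=ww'\qquad(w,w'\in W,\ x\in\mathfrak h^*,\ y\in\mathfrak h),$$ where the unit of $W$ is the unit of the algebra, $x\in\mathfrak h^*$ and $y\in\mathfrak h$ stand for the corresponding linear combinations of the $x_i$ and of the $y_i$, and $W$ acts on $\mathfrak h^*$ by $w(x)=x\circ w^{-1}$. Write $\mathbb C[\mathfrak h]=\mathbb C[x_1,\dots,x_n]$ and $\mathbb C[\mathfrak h^*]=\mathbb C[y_1,\dots,y_n]$. Then the multiplication map $$\mu:\mathbb C[\mathfrak h]\otimes\mathbb C[\mathfrak h^*]\otimes\mathbb C[W]\to H_c,\qquad \mu(f\otimes g\otimes w)=f(x)\,g(y)\,w,$$ is an isomorphism of vector spaces. -/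

import Mathlib

open scoped TensorProduct

noncomputable section

namespace RationalCherednik

variable {V : Type*} [AddCommGroup V] [Module ℂ V]

/-- A linear reflection: an involution whose fixed space is a hyperplane. -/
def IsReflection (s : V ≃ₗ[ℂ] V) : Prop :=
  s * s = 1 ∧
    Module.finrank ℂ (LinearMap.ker ((s : V →ₗ[ℂ] V) - LinearMap.id)) + 1 = Module.finrank ℂ V

/-- The set `Σ ⊆ W` of the reflections that lie in the group `W`. -/
def reflections (W : Subgroup (V ≃ₗ[ℂ] V)) : Set W :=
  {s | IsReflection (s : V ≃ₗ[ℂ] V)}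

/-- The action of `GL(V)` on the dual space: `w(ξ) = ξ ∘ w⁻¹`. -/
def dualAct (w : V ≃ₗ[ℂ] V) (ξ : Module.Dual ℂ V) : Module.Dual ℂ V :=
  ξ ∘ₗ ((w⁻¹ : V ≃ₗ[ℂ] V) : V →ₗ[ℂ] V)

variable [FiniteDimensional ℂ V]

/-- The bilinear form on `V*` obtained from a nondegenerate form `B` on `V` by transport along the
isomorphism `V ≃ V*`, `v ↦ B(v, ·)`. -/
def dualForm (B : LinearMap.BilinForm ℂ V) (hB : B.Nondegenerate) (ξ η : Module.Dual ℂ V) : ℂ :=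
  B ((B.toDual hB).symm ξ) ((B.toDual hB).symm η)

/-- The basis `y₁, …, yₙ` of `V` which corresponds to the basis `x₁, …, xₙ` of `V*` under the
isomorphism `V ≃ V*`, `v ↦ B(v, ·)`. -/
def yBasis {n : ℕ} (B : LinearMap.BilinForm ℂ V) (hB : B.Nondegenerate)
    (x : Module.Basis (Fin n) ℂ (Module.Dual ℂ V)) : Module.Basis (Fin n) ℂ V :=
  x.map (B.toDual hB).symm

/-- The generators `x₁, …, xₙ`, `y₁, …, yₙ` and `w ∈ W`. -/
inductive Gen (n : ℕ) (W : Type*)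
  | x (i : Fin n) : Gen n W
  | y (i : Fin n) : Gen n W
  | w (g : W) : Gen n W

section Free

variable (n : ℕ) (W : Type*)

/-- The generator `xᵢ` in the free algebra. -/
def freeX (i : Fin n) : FreeAlgebra ℂ (Gen n W) := FreeAlgebra.ι ℂ (Gen.x i)

/-- The generator `yᵢ` in the free algebra. -/
def freeY (i : Fin n) : FreeAlgebra ℂ (Gen n W) := FreeAlgebra.ι ℂ (Gen.y i)

/-- The generator `w ∈ W` in the free algebra. -/
def freeW (g : W) : FreeAlgebra ℂ (Gen n W) := FreeAlgebra.ι ℂ (Gen.w g)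

end Free

/-- The linear combination of the free generators `xᵢ` that represents `ξ ∈ V*`. -/
def linX {n : ℕ} (W : Type*) (x : Module.Basis (Fin n) ℂ (Module.Dual ℂ V))
    (ξ : Module.Dual ℂ V) : FreeAlgebra ℂ (Gen n W) :=
  ∑ i, x.repr ξ i • freeX n W i

/-- The linear combination of the free generators `yᵢ` that represents `v ∈ V`. -/
def linY {n : ℕ} (W : Type*) (B : LinearMap.BilinForm ℂ V) (hB : B.Nondegenerate)
    (x : Module.Basis (Fin n) ℂ (Module.Dual ℂ V)) (v : V) : FreeAlgebra ℂ (Gen n W) :=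
  ∑ i, (yBasis B hB x).repr v i • freeY n W i

/-- The defining relations of the Cherednik algebra. -/
inductive Rel {n : ℕ} (W : Subgroup (V ≃ₗ[ℂ] V)) (B : LinearMap.BilinForm ℂ V)
    (hB : B.Nondegenerate) (x : Module.Basis (Fin n) ℂ (Module.Dual ℂ V))
    (α : reflections W → Module.Dual ℂ V) (c : reflections W → ℂ) :
    FreeAlgebra ℂ (Gen n W) → FreeAlgebra ℂ (Gen n W) → Prop
  | x_comm (i j : Fin n) : Rel W B hB x α c
      (freeX n W i * freeX n W j) (freeX n W j * freeX n W i)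
  | y_comm (i j : Fin n) : Rel W B hB x α c
      (freeY n W i * freeY n W j) (freeY n W j * freeY n W i)
  | y_x (i j : Fin n) : Rel W B hB x α c
      (freeY n W i * freeX n W j - freeX n W j * freeY n W i)
      ((if i = j then 1 else 0) +
        ∑ᶠ s : reflections W,
          (c s * (dualForm B hB (x i) (α s) * dualForm B hB (x j) (α s)) /
            dualForm B hB (α s) (α s)) • freeW n W (s : W))
  | w_x (g : W) (ξ : Module.Dual ℂ V) : Rel W B hB x α c
      (freeW n W g * linX W x ξ * freeW n W g⁻¹) (linX W x (dualAct (g : V ≃ₗ[ℂ] V) ξ))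
  | w_y (g : W) (v : V) : Rel W B hB x α c
      (freeW n W g * linY W B hB x v * freeW n W g⁻¹) (linY W B hB x ((g : V ≃ₗ[ℂ] V) v))
  | w_mul (g g' : W) : Rel W B hB x α c (freeW n W g * freeW n W g') (freeW n W (g * g'))
  | w_one : Rel W B hB x α c (freeW n W 1) 1

section Algebra

variable {n : ℕ} (W : Subgroup (V ≃ₗ[ℂ] V)) (B : LinearMap.BilinForm ℂ V)
  (hB : B.Nondegenerate) (x : Module.Basis (Fin n) ℂ (Module.Dual ℂ V))
  (α : reflections W → Module.Dual ℂ V) (c : reflections W → ℂ)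

/-- The rational Cherednik algebra `H_c`. -/
abbrev CherednikAlgebra : Type _ := RingQuot (Rel W B hB x α c)

/-- The quotient map from the free algebra to `H_c`. -/
abbrev toH : FreeAlgebra ℂ (Gen n W) →ₐ[ℂ] CherednikAlgebra W B hB x α c :=
  RingQuot.mkAlgHom ℂ (Rel W B hB x α c)

/-- The element `xᵢ` of `H_c`. -/
def hX (i : Fin n) : CherednikAlgebra W B hB x α c := toH W B hB x α c (freeX n W i)

/-- The element `yᵢ` of `H_c`. -/
def hY (i : Fin n) : CherednikAlgebra W B hB x α c := toH W B hB x α c (freeY n W i)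

lemma hX_comm (i j : Fin n) :
    hX W B hB x α c i * hX W B hB x α c j = hX W B hB x α c j * hX W B hB x α c i := by
  simp only [hX, ← map_mul]
  exact RingQuot.mkAlgHom_rel ℂ (Rel.x_comm i j)

lemma hY_comm (i j : Fin n) :
    hY W B hB x α c i * hY W B hB x α c j = hY W B hB x α c j * hY W B hB x α c i := by
  simp only [hY, ← map_mul]
  exact RingQuot.mkAlgHom_rel ℂ (Rel.y_comm i j)

/-- The group homomorphism `W → H_cˣ`, written as a monoid homomorphism to `H_c`. -/
def hW : W →* CherednikAlgebra W B hB x α c where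
  toFun g := toH W B hB x α c (freeW n W g)
  map_one' := by
    rw [← map_one (toH W B hB x α c)]
    exact RingQuot.mkAlgHom_rel ℂ Rel.w_one
  map_mul' g g' := by
    rw [← map_mul]
    exact (RingQuot.mkAlgHom_rel ℂ (Rel.w_mul g g')).symm

end Algebra

/-- Evaluation of polynomials at pairwise commuting elements of a (noncommutative) algebra. -/
def evalCommuting {n : ℕ} {A : Type*} [Ring A] [Algebra ℂ A] (a : Fin n → A)
    (ha : ∀ i j, a i * a j = a j * a i) : MvPolynomial (Fin n) ℂ →ₐ[ℂ] A :=
  letI : CommSemiring (Algebra.adjoin ℂ (Set.range a)) :=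
    { (Algebra.adjoin ℂ (Set.range a)).toSemiring with
      mul_comm := (Algebra.isMulCommutative_adjoin ℂ (by
        rintro _ ⟨i, rfl⟩ _ ⟨j, rfl⟩
        exact ha i j)).is_comm.comm }
  (Algebra.adjoin ℂ (Set.range a)).val.comp
    (MvPolynomial.aeval fun i => ⟨a i, Algebra.subset_adjoin ⟨i, rfl⟩⟩)

lemma evalCommuting_X {n : ℕ} {A : Type*} [Ring A] [Algebra ℂ A] (a : Fin n → A)
    (ha : ∀ i j, a i * a j = a j * a i) (i : Fin n) :
    evalCommuting a ha (MvPolynomial.X i) = a i := by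
  simp [evalCommuting]

section Multiplication

variable {n : ℕ} (W : Subgroup (V ≃ₗ[ℂ] V)) (B : LinearMap.BilinForm ℂ V)
  (hB : B.Nondegenerate) (x : Module.Basis (Fin n) ℂ (Module.Dual ℂ V))
  (α : reflections W → Module.Dual ℂ V) (c : reflections W → ℂ)

/-- `f ↦ f(x)`, from `ℂ[V] = ℂ[x₁, …, xₙ]` to `H_c`. -/
def polyX : MvPolynomial (Fin n) ℂ →ₐ[ℂ] CherednikAlgebra W B hB x α c :=
  evalCommuting (hX W B hB x α c) (hX_comm W B hB x α c)

/-- `g ↦ g(y)`, from `ℂ[V*] = ℂ[y₁, …, yₙ]` to `H_c`. -/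
def polyY : MvPolynomial (Fin n) ℂ →ₐ[ℂ] CherednikAlgebra W B hB x α c :=
  evalCommuting (hY W B hB x α c) (hY_comm W B hB x α c)

/-- The algebra homomorphism `ℂ[W] → H_c`. -/
def groupAlgHom : MonoidAlgebra ℂ W →ₐ[ℂ] CherednikAlgebra W B hB x α c :=
  MonoidAlgebra.lift ℂ _ W (hW W B hB x α c)

/-- The multiplication map `μ : ℂ[V] ⊗ ℂ[V*] ⊗ ℂ[W] → H_c`. -/
def mulMap : (MvPolynomial (Fin n) ℂ ⊗[ℂ] MvPolynomial (Fin n) ℂ) ⊗[ℂ] MonoidAlgebra ℂ W →ₗ[ℂ]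
    CherednikAlgebra W B hB x α c :=
  LinearMap.mul' ℂ _ ∘ₗ TensorProduct.map
    (LinearMap.mul' ℂ _ ∘ₗ
      TensorProduct.map (polyX W B hB x α c).toLinearMap (polyY W B hB x α c).toLinearMap)
    (groupAlgHom W B hB x α c).toLinearMap

lemma mulMap_tmul (f g : MvPolynomial (Fin n) ℂ) (w : W) :
    mulMap W B hB x α c ((f ⊗ₜ[ℂ] g) ⊗ₜ[ℂ] MonoidAlgebra.of ℂ W w) =
      polyX W B hB x α c f * polyY W B hB x α c g * hW W B hB x α c w := by
  simp [mulMap, groupAlgHom]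

end Multiplication

end RationalCherednik

end

/-!
Surjectivity of `μ` is a matter of reordering: the relations move `w` past the `xᵢ` and `yᵢ`, and
`yᵢ` past the `xⱼ` up to terms of lower degree in the `xⱼ`. The range of `μ` is therefore a left
ideal that contains `1` (`mulMap_surjective`).

For injectivity one constructs the module that `H_c` ought to be. Let `N` be any module over
`ℂ[V*] ⋊ W`. The algebra `H_c` acts on `ℂ[V] ⊗ N`: the `xᵢ` by multiplication, `W` diagonally, and
`v ∈ V` by the Dunkl operator with coefficients in `N`,
`f ⊗ m ↦ f ⊗ vm + ∂ᵥf ⊗ m + ∑ₛ (cₛ/2) αₛ(v) (f - s f)/αₛ ⊗ s m`.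
The commutator with `xⱼ` comes from the twisted Leibniz rule (`dunkl_mul_mulOp`), and equivariance
under `W` from the invariance of `c` and the fact that `αₛ` is unique up to a scalar
(`groupOp_mul_dunkl`, `root_conj_smul`). The Dunkl operators commute with each other
(`dunkl_commute`): the Jacobi identity and equivariance show that the commutator of two of them
commutes with multiplication by every `xⱼ`, and it vanishes on `1 ⊗ N`, where the Dunkl operators
act through `N`.

Now take for `N` the regular module `ℂ[V*] ⊗ ℂ[W]`. The element `μ(f ⊗ g ⊗ w)` takes the
vector `1 ⊗ (1 ⊗ 1)` to `f ⊗ (g ⊗ w)`, so the action on this vector is a left inverse of `μ` up to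
reassociation (`mulMap_injective_of_action`).
-/

noncomputable section

namespace RationalCherednik

/-! ### Linear substitutions in polynomial rings -/

section PolynomialAction

variable {U : Type*} [AddCommGroup U] [Module ℂ U] {n : ℕ} (b : Module.Basis (Fin n) ℂ U)

/-- The linear polynomial that represents a vector, when `ℂ[X₁, …, Xₙ]` is read as the symmetric
algebra of a space with basis `b`. -/
def linPoly : U →ₗ[ℂ] MvPolynomial (Fin n) ℂ := b.constr ℂ MvPolynomial.X

lemma linPoly_basis (i : Fin n) : linPoly b (b i) = MvPolynomial.X i := by
  simp [linPoly]

lemma linPoly_eq_sum (u : U) : linPoly b u = ∑ i, b.repr u i • MvPolynomial.X i := by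
  simp [linPoly, Module.Basis.constr_apply_fintype]

lemma linPoly_ne_zero {u : U} (hu : u ≠ 0) : linPoly b u ≠ 0 := by
  intro h
  refine hu (b.repr.injective (Finsupp.ext fun i => ?_))
  have h' := congrArg (MvPolynomial.coeff (Finsupp.single i 1)) h
  rw [linPoly_eq_sum, MvPolynomial.coeff_sum] at h'
  simpa [MvPolynomial.coeff_X, Finsupp.single_left_inj] using h'

/-- The endomorphism of the symmetric algebra induced by a linear endomorphism. -/
def polyAct (φ : U →ₗ[ℂ] U) : MvPolynomial (Fin n) ℂ →ₐ[ℂ] MvPolynomial (Fin n) ℂ :=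
  MvPolynomial.aeval fun i => linPoly b (φ (b i))

lemma polyAct_linPoly (φ : U →ₗ[ℂ] U) (u : U) :
    polyAct b φ (linPoly b u) = linPoly b (φ u) := by
  have : (polyAct b φ).toLinearMap ∘ₗ linPoly b = linPoly b ∘ₗ φ :=
    b.ext fun i => by simp [linPoly_basis, polyAct]
  exact LinearMap.congr_fun this u

lemma polyAct_X (φ : U →ₗ[ℂ] U) (i : Fin n) :
    polyAct b φ (MvPolynomial.X i) = linPoly b (φ (b i)) := by
  simp [polyAct]

lemma polyAct_id : polyAct b LinearMap.id = AlgHom.id ℂ _ := by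
  ext1 i
  simp [polyAct_X, linPoly_basis]

lemma polyAct_comp (φ ψ : U →ₗ[ℂ] U) :
    polyAct b (φ ∘ₗ ψ) = (polyAct b φ).comp (polyAct b ψ) := by
  ext1 i
  simp [polyAct_X, polyAct_linPoly]

end PolynomialAction

/-! ### Divided differences -/

/-- If an endomorphism `σ` of a polynomial ring moves each variable by a multiple of `l`, then
`(f - σ f) / l` is again a polynomial, which depends linearly on `f`. -/
lemma exists_dividedDifference {n : ℕ} {l : MvPolynomial (Fin n) ℂ} (hl : l ≠ 0)
    (σ : MvPolynomial (Fin n) ℂ →ₐ[ℂ] MvPolynomial (Fin n) ℂ)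
    (h : ∀ i, l ∣ MvPolynomial.X i - σ (MvPolynomial.X i)) :
    ∃ Δ : MvPolynomial (Fin n) ℂ →ₗ[ℂ] MvPolynomial (Fin n) ℂ, ∀ f, l * Δ f = f - σ f := by
  have hdvd : ∀ f, l ∣ f - σ f := by
    intro f
    induction f using MvPolynomial.induction_on with
    | C a => simp [show σ (MvPolynomial.C a) = MvPolynomial.C a from σ.commutes a]
    | add p q hp hq => simpa [add_sub_add_comm] using dvd_add hp hq
    | mul_X p i hp =>
      have : p * MvPolynomial.X i - σ (p * MvPolynomial.X i)
          = (p - σ p) * MvPolynomial.X i + σ p * (MvPolynomial.X i - σ (MvPolynomial.X i)) := by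
        rw [map_mul]; ring
      rw [this]
      exact dvd_add (hp.mul_right _) ((h i).mul_left _)
  choose Δ hΔ using hdvd
  refine ⟨⟨⟨Δ, fun f g => mul_left_cancel₀ hl ?_⟩, fun a f => mul_left_cancel₀ hl ?_⟩,
    fun f => (hΔ f).symm⟩
  · rw [← hΔ, mul_add, ← hΔ, ← hΔ, map_add]; ring
  · rw [← hΔ, RingHom.id_apply, mul_smul_comm, ← hΔ, map_smul, smul_sub]

/-! ### Reflections -/

section Reflections

variable {V : Type*} [AddCommGroup V] [Module ℂ V]

/-- An invariant nondegenerate symmetric form turns a reflection `s` with root `β` into the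
orthogonal reflection `v ↦ v - 2 (β(v) / β(b)) b`, where `b` is the vector dual to `β`. -/
lemma IsReflection.apply_eq [FiniteDimensional ℂ V] {s : V ≃ₗ[ℂ] V} (hs : IsReflection s)
    (B : LinearMap.BilinForm ℂ V) (hB : B.Nondegenerate)
    (hBs : ∀ u v, B (s u) (s v) = B u v) {β : Module.Dual ℂ V} (hβ : β ≠ 0)
    (hβs : ∀ v, β (s v) = -β v) :
    β ((B.toDual hB).symm β) ≠ 0 ∧
      ∀ v, s v = v - (2 * β v / β ((B.toDual hB).symm β)) • (B.toDual hB).symm β := by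
  set b := (B.toDual hB).symm β with hb
  have hBb : ∀ v, B b v = β v := fun v => by
    rw [← LinearMap.BilinForm.toDual_def hB, hb, LinearEquiv.apply_symm_apply]
  have hss : ∀ v, s (s v) = v := fun v => LinearEquiv.congr_fun hs.1 v
  have hle : LinearMap.ker ((s : V →ₗ[ℂ] V) - LinearMap.id) ≤ LinearMap.ker β := by
    intro v hv
    have hv' : s v = v := by simpa [sub_eq_zero] using hv
    have := hβs v
    rw [hv'] at this
    exact self_eq_neg.mp this
  have hker : LinearMap.ker ((s : V →ₗ[ℂ] V) - LinearMap.id) = LinearMap.ker β := by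
    refine Submodule.eq_of_le_of_finrank_eq hle ?_
    have h1 := hs.2
    have h2 := Module.Dual.finrank_ker_add_one_of_ne_zero hβ
    omega
  have hfix : ∀ v, β v = 0 → s v = v := fun v hv => by
    have : v ∈ LinearMap.ker ((s : V →ₗ[ℂ] V) - LinearMap.id) := by rw [hker]; exact hv
    simpa [sub_eq_zero] using this
  have hsb : s b = -b := by
    apply (B.toDual hB).injective
    ext v
    rw [LinearMap.BilinForm.toDual_def, map_neg, LinearMap.neg_apply,
      LinearMap.BilinForm.toDual_def, hBb, ← hβs, ← hBb, ← hBs b (s v), hss]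
  have hb0 : β b ≠ 0 := by
    intro h0
    have h1 := hfix b h0
    rw [hsb] at h1
    have h2 : b = 0 := by
      have h3 : (2 : ℂ) • b = 0 := by rw [two_smul]; nth_rewrite 1 [← h1]; simp
      simpa using h3
    exact hβ ((LinearEquiv.map_eq_zero_iff _).mp h2)
  refine ⟨hb0, fun v => ?_⟩
  have h1 : s (v - (β v / β b) • b) = v - (β v / β b) • b :=
    hfix _ (by simp [hb0])
  rw [map_sub, map_smul, hsb, sub_eq_iff_eq_add] at h1
  rw [h1, mul_div_assoc, two_mul]
  module

lemma IsReflection.conj {s : V ≃ₗ[ℂ] V} (hs : IsReflection s) (g : V ≃ₗ[ℂ] V) :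
    IsReflection (g * s * g⁻¹) := by
  have hss : ∀ v, s (s v) = v := fun v => LinearEquiv.congr_fun hs.1 v
  have hgg : ∀ v, g⁻¹ (g v) = v := fun v => g.symm_apply_apply v
  have hgg' : ∀ v, g (g⁻¹ v) = v := fun v => g.apply_symm_apply v
  refine ⟨?_, ?_⟩
  · ext v
    simp [LinearEquiv.mul_apply, hss]
  · rw [← hs.2]
    congr 1
    have : LinearMap.ker (((g * s * g⁻¹ : V ≃ₗ[ℂ] V) : V →ₗ[ℂ] V) - LinearMap.id) =
        (LinearMap.ker ((s : V →ₗ[ℂ] V) - LinearMap.id)).map (g : V →ₗ[ℂ] V) := by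
      ext v
      simp only [LinearMap.mem_ker, LinearMap.sub_apply, LinearEquiv.coe_coe, LinearMap.id_coe,
        id_eq, LinearEquiv.mul_apply, Submodule.mem_map, sub_eq_zero]
      constructor
      · intro h
        refine ⟨g⁻¹ v, ?_, hgg' v⟩
        rw [← hgg (s (g⁻¹ v)), h]
      · rintro ⟨u, hu, rfl⟩
        rw [hgg, hu]
    rw [this]
    exact LinearEquiv.finrank_map_eq g _

/-- Conjugation by `g ∈ W` permutes the reflections of `W`. -/
def conjReflections (W : Subgroup (V ≃ₗ[ℂ] V)) (g : W) : reflections W ≃ reflections W where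
  toFun s := ⟨g * s * g⁻¹, IsReflection.conj s.2 g⟩
  invFun s := ⟨g⁻¹ * s * g, by
    simpa [reflections] using IsReflection.conj s.2 (g⁻¹ : W)⟩
  left_inv s := Subtype.ext (by simp [mul_assoc])
  right_inv s := Subtype.ext (by simp [mul_assoc])

end Reflections

/-! ### Dunkl operators with coefficients -/

/-- If the commutators of `D` and `E` with `M` are scalars plus combinations of elements `G s`, with
`[D, G s]` and `[E, G s]` proportional to one element `F s`, then the two double commutators
`[[D, M], E]` and `[[E, M], D]` have the symmetric coefficients `k s * (a s * b s)`. By the Jacobi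
identity `[D, E]` then commutes with `M`. -/
lemma commutator_mul_comm {A S : Type*} [Ring A] [Algebra ℂ A] [Fintype S] {D E M : A} {p q : ℂ}
    (k a b : S → ℂ) {F G : S → A}
    (hD : D * M = M * D + algebraMap ℂ A p + ∑ s, (k s * a s) • G s)
    (hE : E * M = M * E + algebraMap ℂ A q + ∑ s, (k s * b s) • G s)
    (hGD : ∀ s, G s * D + a s • F s = D * G s) (hGE : ∀ s, G s * E + b s • F s = E * G s) :
    (D * E - E * D) * M = M * (D * E - E * D) := by
  have h1 : D * E * M = M * (D * E) + p • E + q • D + ∑ s, (k s * a s) • (E * G s) +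
      ∑ s, (k s * b s) • (D * G s) - ∑ s, (k s * (a s * b s)) • F s := by
    rw [mul_assoc, hE, mul_add, mul_add, ← mul_assoc, hD, add_mul, add_mul, Finset.sum_mul,
      Finset.mul_sum, ← Algebra.commutes, ← Algebra.smul_def, ← Algebra.smul_def]
    simp only [smul_mul_assoc, mul_smul_comm, fun s => eq_sub_of_add_eq (hGE s), smul_sub,
      Finset.sum_sub_distrib, smul_smul, mul_assoc]
    abel
  have h2 : E * D * M = M * (E * D) + p • E + q • D + ∑ s, (k s * a s) • (E * G s) +
      ∑ s, (k s * b s) • (D * G s) - ∑ s, (k s * (a s * b s)) • F s := by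
    rw [mul_assoc, hD, mul_add, mul_add, ← mul_assoc, hE, add_mul, add_mul, Finset.sum_mul,
      Finset.mul_sum, ← Algebra.commutes, ← Algebra.smul_def, ← Algebra.smul_def]
    simp only [smul_mul_assoc, mul_smul_comm, fun s => eq_sub_of_add_eq (hGD s), smul_sub,
      Finset.sum_sub_distrib, smul_smul, mul_assoc, fun s => mul_comm (b s) (a s)]
    abel
  rw [sub_mul, h1, h2, mul_sub]
  abel

section Dunkl

variable {V : Type*} [AddCommGroup V] [Module ℂ V] {n : ℕ}
  (W : Subgroup (V ≃ₗ[ℂ] V)) (x : Module.Basis (Fin n) ℂ (Module.Dual ℂ V))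

/-- The action of `W` on `ℂ[V]`, by `w(f) = f ∘ w⁻¹`. -/
def actX (g : W) : MvPolynomial (Fin n) ℂ →ₐ[ℂ] MvPolynomial (Fin n) ℂ :=
  polyAct x ((g⁻¹ : W) : V ≃ₗ[ℂ] V).toLinearMap.dualMap

variable {W}

lemma actX_linPoly (g : W) (ξ : Module.Dual ℂ V) :
    actX W x g (linPoly x ξ) = linPoly x (dualAct (g : V ≃ₗ[ℂ] V) ξ) :=
  polyAct_linPoly _ _ _

lemma actX_one : actX W x 1 = AlgHom.id ℂ _ := by
  rw [actX, ← polyAct_id x]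
  congr 1

lemma actX_mul (g h : W) : actX W x (g * h) = (actX W x g).comp (actX W x h) := by
  rw [actX, actX, actX, ← polyAct_comp]
  rw [mul_inv_rev]
  rfl

/-- The derivative of polynomial functions on `V` in the direction of a vector. -/
def dirDeriv (v : V) : Derivation ℂ (MvPolynomial (Fin n) ℂ) (MvPolynomial (Fin n) ℂ) :=
  MvPolynomial.mkDerivation ℂ fun i => MvPolynomial.C (x i v)

lemma dirDeriv_linPoly (v : V) (ξ : Module.Dual ℂ V) :
    dirDeriv x v (linPoly x ξ) = MvPolynomial.C (ξ v) := by
  have : (dirDeriv x v : MvPolynomial (Fin n) ℂ →ₗ[ℂ] MvPolynomial (Fin n) ℂ) ∘ₗ linPoly x =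
      Algebra.linearMap ℂ _ ∘ₗ LinearMap.applyₗ v :=
    x.ext fun i => by simp [linPoly_basis, dirDeriv, MvPolynomial.algebraMap_eq]
  exact LinearMap.congr_fun this ξ

lemma dirDeriv_add (u v : V) (f : MvPolynomial (Fin n) ℂ) :
    dirDeriv x (u + v) f = dirDeriv x u f + dirDeriv x v f := by
  have : dirDeriv x (u + v) = dirDeriv x u + dirDeriv x v :=
    MvPolynomial.derivation_ext fun i => by simp [dirDeriv]
  rw [this, Derivation.add_apply]

lemma dirDeriv_smul (a : ℂ) (v : V) (f : MvPolynomial (Fin n) ℂ) :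
    dirDeriv x (a • v) f = a • dirDeriv x v f := by
  have : dirDeriv x (a • v) = a • dirDeriv x v :=
    MvPolynomial.derivation_ext fun i => by simp [dirDeriv, MvPolynomial.smul_eq_C_mul]
  rw [this, Derivation.smul_apply]

lemma actX_dirDeriv (g : W) (v : V) (f : MvPolynomial (Fin n) ℂ) :
    actX W x g (dirDeriv x v f) = dirDeriv x ((g : V ≃ₗ[ℂ] V) v) (actX W x g f) := by
  induction f using MvPolynomial.induction_on with
  | C a =>
    simp [show ∀ a, actX W x g (MvPolynomial.C a) = MvPolynomial.C a from (actX W x g).commutes]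
  | add p q hp hq => simp only [map_add, hp, hq]
  | mul_X p i hp =>
    have h1 : dualAct (g : V ≃ₗ[ℂ] V) (x i) ((g : V ≃ₗ[ℂ] V) v) = x i v := by
      change x i ((g : V ≃ₗ[ℂ] V).symm ((g : V ≃ₗ[ℂ] V) v)) = _
      rw [LinearEquiv.symm_apply_apply]
    rw [← linPoly_basis x, Derivation.leibniz, map_mul, Derivation.leibniz, map_add,
      dirDeriv_linPoly, actX_linPoly, dirDeriv_linPoly, h1, smul_eq_mul, smul_eq_mul,
      smul_eq_mul, smul_eq_mul, map_mul, map_mul, hp, actX_linPoly,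
      show actX W x g (MvPolynomial.C _) = _ from (actX W x g).commutes _]
    rfl

variable {N : Type*} [AddCommGroup N] [Module ℂ N]
  {α : reflections W → Module.Dual ℂ V}
  {Δ : reflections W → MvPolynomial (Fin n) ℂ →ₗ[ℂ] MvPolynomial (Fin n) ℂ}
  (τ : W →* Module.End ℂ N)

lemma divDiff_C (hα : ∀ s, α s ≠ 0)
    (hΔ : ∀ s f, linPoly x (α s) * Δ s f = f - actX W x s f)
    (s : reflections W) (a : ℂ) : Δ s (MvPolynomial.C a) = 0 := by
  have h := hΔ s (MvPolynomial.C a)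
  rw [show actX W x (s : W) (MvPolynomial.C a) = MvPolynomial.C a from
    (actX W x (s : W)).commutes a, sub_self] at h
  exact (mul_eq_zero.mp h).resolve_left (linPoly_ne_zero x (hα s))

/-- The twisted Leibniz rule for divided differences. -/
lemma divDiff_linPoly_mul (hα : ∀ s, α s ≠ 0)
    (hΔ : ∀ s f, linPoly x (α s) * Δ s f = f - actX W x s f)
    {s : reflections W} {ξ : Module.Dual ℂ V} {k : ℂ}
    (hk : dualAct ((s : W) : V ≃ₗ[ℂ] V) ξ = ξ - k • α s) (f : MvPolynomial (Fin n) ℂ) :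
    Δ s (linPoly x ξ * f) = linPoly x ξ * Δ s f + k • actX W x s f := by
  apply mul_left_cancel₀ (linPoly_ne_zero x (hα s))
  rw [hΔ, map_mul, actX_linPoly, hk, map_sub, map_smul, mul_add, mul_left_comm, hΔ,
    mul_smul_comm, sub_mul, smul_mul_assoc]
  ring

/-- Multiplication by a polynomial on `ℂ[V] ⊗ N`. -/
def mulOp (N : Type*) [AddCommGroup N] [Module ℂ N] :
    MvPolynomial (Fin n) ℂ →ₐ[ℂ] Module.End ℂ (MvPolynomial (Fin n) ℂ ⊗[ℂ] N) :=
  Algebra.lsmul ℂ ℂ _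

lemma mulOp_tmul (p f : MvPolynomial (Fin n) ℂ) (m : N) :
    mulOp N p (f ⊗ₜ[ℂ] m) = (p * f) ⊗ₜ m := by
  simp [mulOp, TensorProduct.smul_tmul']

/-- The diagonal action of `W` on `ℂ[V] ⊗ N`. -/
def groupOp : W →* Module.End ℂ (MvPolynomial (Fin n) ℂ ⊗[ℂ] N) where
  toFun g := TensorProduct.map (actX W x g).toLinearMap (τ g)
  map_one' := by ext; simp [actX_one]
  map_mul' g h := by ext; simp [actX_mul]

lemma groupOp_tmul (g : W) (f : MvPolynomial (Fin n) ℂ) (m : N) :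
    groupOp x τ g (f ⊗ₜ m) = actX W x g f ⊗ₜ τ g m := rfl

/-- Two linear operators on `ℂ[V] ⊗ N` agree when they agree on constants and their difference
commutes with the linear functions. -/
lemma eq_of_commute_mulOp {P Q : Module.End ℂ (MvPolynomial (Fin n) ℂ ⊗[ℂ] N)}
    (h1 : ∀ m : N, P (1 ⊗ₜ m) = Q (1 ⊗ₜ m))
    (h2 : ∀ ξ, (P - Q) * mulOp N (linPoly x ξ) = mulOp N (linPoly x ξ) * (P - Q)) : P = Q := by
  refine TensorProduct.ext' fun f m => sub_eq_zero.mp ?_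
  rw [← LinearMap.sub_apply]
  induction f using MvPolynomial.induction_on with
  | C a =>
    rw [show (MvPolynomial.C a : MvPolynomial (Fin n) ℂ) = a • 1 by
      rw [MvPolynomial.smul_eq_C_mul, mul_one], TensorProduct.smul_tmul, LinearMap.sub_apply, h1,
      sub_self]
  | add p q hp hq => rw [TensorProduct.add_tmul, map_add, hp, hq, add_zero]
  | mul_X p i hp =>
    have := LinearMap.congr_fun (h2 (x i)) (p ⊗ₜ m)
    rwa [Module.End.mul_apply, Module.End.mul_apply, hp, map_zero, mulOp_tmul, linPoly_basis,
      mul_comm] at this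


variable [Fintype (reflections W)] (α) (κ : reflections W → ℂ) (Δ)
  (Y : V →ₗ[ℂ] Module.End ℂ N)

/-- The Dunkl operator with coefficients in `N`, in the direction of `v`:
`f ⊗ m ↦ f ⊗ vm + ∂ᵥf ⊗ m + ∑ₛ κₛ αₛ(v) (f - s f) / αₛ ⊗ s m`. Here `Δ s` stands for
the divided difference `f ↦ (f - s f) / αₛ`. -/
def dunkl (v : V) : Module.End ℂ (MvPolynomial (Fin n) ℂ ⊗[ℂ] N) :=
  TensorProduct.map LinearMap.id (Y v) +
    TensorProduct.map (dirDeriv x v : MvPolynomial (Fin n) ℂ →ₗ[ℂ] MvPolynomial (Fin n) ℂ)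
      LinearMap.id +
    ∑ s : reflections W, (κ s * α s v) • TensorProduct.map (Δ s) (τ s)

lemma dunkl_tmul (v : V) (f : MvPolynomial (Fin n) ℂ) (m : N) :
    dunkl x α Δ τ κ Y v (f ⊗ₜ m) = f ⊗ₜ Y v m + dirDeriv x v f ⊗ₜ m +
      ∑ s : reflections W, (κ s * α s v) • (Δ s f ⊗ₜ[ℂ] τ s m) := by
  simp [dunkl]

lemma dunkl_add (u v : V) :
    dunkl x α Δ τ κ Y (u + v) = dunkl x α Δ τ κ Y u + dunkl x α Δ τ κ Y v := by
  refine TensorProduct.ext' fun f m => ?_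
  simp only [LinearMap.add_apply, dunkl_tmul, dirDeriv_add, map_add, mul_add, add_smul,
    Finset.sum_add_distrib, TensorProduct.add_tmul, TensorProduct.tmul_add]
  abel

lemma dunkl_smul (a : ℂ) (v : V) :
    dunkl x α Δ τ κ Y (a • v) = a • dunkl x α Δ τ κ Y v := by
  refine TensorProduct.ext' fun f m => ?_
  simp only [LinearMap.smul_apply, dunkl_tmul, dirDeriv_smul, map_smul, smul_eq_mul,
    smul_add, Finset.smul_sum, TensorProduct.tmul_smul, TensorProduct.smul_tmul', smul_smul]
  simp only [mul_left_comm]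

variable {α κ Δ Y τ}

lemma dunkl_one_tmul (hα : ∀ s, α s ≠ 0)
    (hΔ : ∀ s f, linPoly x (α s) * Δ s f = f - actX W x s f)
    (v : V) (m : N) :
    dunkl x α Δ τ κ Y v (1 ⊗ₜ m) = 1 ⊗ₜ Y v m := by
  have h : ∀ s, Δ s 1 = 0 := fun s => by simpa using divDiff_C x hα hΔ s 1
  simp [dunkl_tmul, h]

/-- The commutator of a Dunkl operator with multiplication by a linear function. The number
`k s` is the coefficient of `αₛ` in `ξ - s(ξ)`. -/
lemma dunkl_mul_mulOp (hα : ∀ s, α s ≠ 0)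
    (hΔ : ∀ s f, linPoly x (α s) * Δ s f = f - actX W x s f)
    (v : V) (ξ : Module.Dual ℂ V) (k : reflections W → ℂ)
    (hk : ∀ s : reflections W, dualAct ((s : W) : V ≃ₗ[ℂ] V) ξ = ξ - k s • α s) :
    dunkl x α Δ τ κ Y v * mulOp N (linPoly x ξ) =
      mulOp N (linPoly x ξ) * dunkl x α Δ τ κ Y v + algebraMap ℂ _ (ξ v) +
        ∑ s : reflections W, (κ s * α s v * k s) • groupOp x τ (s : W) := by
  refine TensorProduct.ext' fun f m => ?_
  simp only [Module.End.mul_apply, LinearMap.add_apply, mulOp_tmul, dunkl_tmul, map_add, map_sum,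
    LinearMap.sum_apply, LinearMap.smul_apply, groupOp_tmul, Derivation.leibniz,
    divDiff_linPoly_mul x hα hΔ (hk _), dirDeriv_linPoly, Module.algebraMap_end_apply,
    TensorProduct.add_tmul, smul_add, Finset.sum_add_distrib, TensorProduct.smul_tmul',
    smul_smul, smul_eq_mul]
  simp only [mul_comm f, ← MvPolynomial.smul_eq_C_mul, mul_smul_comm]
  abel

/-- Dunkl operators are `W`-equivariant, provided that `κ` is invariant and that the
roots `αₛ` and `α_{gsg⁻¹}` are proportional in the way that `hprop` says. -/
lemma groupOp_mul_dunkl (hα : ∀ s, α s ≠ 0)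
    (hΔ : ∀ s f, linPoly x (α s) * Δ s f = f - actX W x s f)
    (hY : ∀ (g : W) (v : V), τ g * Y v = Y ((g : V ≃ₗ[ℂ] V) v) * τ g)
    (hκ : ∀ (g : W) s, κ (conjReflections W g s) = κ s)
    (hprop : ∀ (g : W) s v, α (conjReflections W g s) ((g : V ≃ₗ[ℂ] V) v) •
      dualAct (g : V ≃ₗ[ℂ] V) (α s) = α s v • α (conjReflections W g s))
    (g : W) (v : V) :
    groupOp x τ g * dunkl x α Δ τ κ Y v =
      dunkl x α Δ τ κ Y ((g : V ≃ₗ[ℂ] V) v) * groupOp x τ g := by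
  have hconj : ∀ s, ((conjReflections W g s : reflections W) : W) * g = g * s := fun s => by
    simp [conjReflections]
  have key : ∀ s f, α s v • actX W x g (Δ s f) =
      α (conjReflections W g s) ((g : V ≃ₗ[ℂ] V) v) •
        Δ (conjReflections W g s) (actX W x g f) := by
    intro s f
    have hd : dualAct (g : V ≃ₗ[ℂ] V) (α s) ≠ 0 := fun h0 => hα s <| by
      ext u
      have := LinearMap.congr_fun h0 ((g : V ≃ₗ[ℂ] V) u)
      change α s ((g : V ≃ₗ[ℂ] V).symm ((g : V ≃ₗ[ℂ] V) u)) = 0 at this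
      rwa [LinearEquiv.symm_apply_apply] at this
    apply mul_left_cancel₀ (linPoly_ne_zero x hd)
    rw [mul_smul_comm, mul_smul_comm, ← smul_mul_assoc (α (conjReflections W g s) _),
      ← map_smul (linPoly x), hprop, map_smul, smul_mul_assoc, hΔ, ← actX_linPoly, ← map_mul,
      hΔ, map_sub,
      ← AlgHom.comp_apply, ← AlgHom.comp_apply, ← actX_mul, ← actX_mul, hconj]
  refine TensorProduct.ext' fun f m => ?_
  have hYm : τ g (Y v m) = Y ((g : V ≃ₗ[ℂ] V) v) (τ g m) := LinearMap.congr_fun (hY g v) m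
  simp only [Module.End.mul_apply, dunkl_tmul, map_add, map_sum, map_smul, groupOp_tmul,
    actX_dirDeriv, hYm]
  congr 1
  rw [← Equiv.sum_comp (conjReflections W g)
    fun t => (κ t * α t ((g : V ≃ₗ[ℂ] V) v)) • (Δ t (actX W x g f) ⊗ₜ[ℂ] τ t (τ g m))]
  refine Finset.sum_congr rfl fun s _ => ?_
  rw [hκ, mul_smul, mul_smul, TensorProduct.smul_tmul', TensorProduct.smul_tmul', key,
    ← Module.End.mul_apply, ← Module.End.mul_apply, ← map_mul, ← map_mul, hconj]
  simp only [TensorProduct.smul_tmul']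

/-- Dunkl operators commute: by equivariance the commutator of two of them commutes with all
multiplication operators, and it vanishes on constants. The vector `a s` is the coroot of `αₛ`. -/
lemma dunkl_commute (hα : ∀ s, α s ≠ 0)
    (hΔ : ∀ s f, linPoly x (α s) * Δ s f = f - actX W x s f)
    (hY : ∀ (g : W) (v : V), τ g * Y v = Y ((g : V ≃ₗ[ℂ] V) v) * τ g)
    (hYY : ∀ u v, Y u * Y v = Y v * Y u)
    (hκ : ∀ (g : W) s, κ (conjReflections W g s) = κ s)
    (hprop : ∀ (g : W) s v, α (conjReflections W g s) ((g : V ≃ₗ[ℂ] V) v) •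
      dualAct (g : V ≃ₗ[ℂ] V) (α s) = α s v • α (conjReflections W g s))
    (a : reflections W → V)
    (ha : ∀ (s : reflections W) v, ((s : W) : V ≃ₗ[ℂ] V) v = v - α s v • a s)
    (hξ : ∀ (s : reflections W) (ξ : Module.Dual ℂ V),
      dualAct ((s : W) : V ≃ₗ[ℂ] V) ξ = ξ - ξ (a s) • α s)
    (u v : V) :
    dunkl x α Δ τ κ Y u * dunkl x α Δ τ κ Y v = dunkl x α Δ τ κ Y v * dunkl x α Δ τ κ Y u := by
  refine eq_of_commute_mulOp x (fun m => ?_) fun ξ => ?_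
  · have := LinearMap.congr_fun (hYY u v) m
    simp only [Module.End.mul_apply] at this
    simp only [Module.End.mul_apply, dunkl_one_tmul x hα hΔ, this]
  have hs : ∀ (s : reflections W) w, groupOp x τ (s : W) * dunkl x α Δ τ κ Y w +
      α s w • (dunkl x α Δ τ κ Y (a s) * groupOp x τ (s : W)) =
      dunkl x α Δ τ κ Y w * groupOp x τ (s : W) := by
    intro s w
    rw [groupOp_mul_dunkl x hα hΔ hY hκ hprop, ← smul_mul_assoc, ← dunkl_smul, ← add_mul,
      ← dunkl_add, ha, sub_add_cancel]
  refine commutator_mul_comm (A := Module.End ℂ (MvPolynomial (Fin n) ℂ ⊗[ℂ] N))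
    (p := ξ u) (q := ξ v) (F := fun s => dunkl x α Δ τ κ Y (a s) * groupOp x τ (s : W))
    (fun s => κ s * ξ (a s)) (fun s => α s u) (fun s => α s v) ?_ ?_
    (fun s => hs s u) (fun s => hs s v)
  · rw [dunkl_mul_mulOp x hα hΔ u ξ (fun s => ξ (a s)) fun s => hξ s ξ]
    simp only [mul_right_comm (κ _)]
  · rw [dunkl_mul_mulOp x hα hΔ v ξ (fun s => ξ (a s)) fun s => hξ s ξ]
    simp only [mul_right_comm (κ _)]

end Dunkl

/-! ### Surjectivity of the multiplication map -/

section Spanning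

variable {V : Type*} [AddCommGroup V] [Module ℂ V] [FiniteDimensional ℂ V] {n : ℕ}
  (W : Subgroup (V ≃ₗ[ℂ] V)) (B : LinearMap.BilinForm ℂ V)
  (hB : B.Nondegenerate) (x : Module.Basis (Fin n) ℂ (Module.Dual ℂ V))
  (α : reflections W → Module.Dual ℂ V) (c : reflections W → ℂ)

lemma polyX_X (i : Fin n) : polyX W B hB x α c (MvPolynomial.X i) = hX W B hB x α c i :=
  evalCommuting_X _ _ i

lemma polyY_X (i : Fin n) : polyY W B hB x α c (MvPolynomial.X i) = hY W B hB x α c i :=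
  evalCommuting_X _ _ i

lemma polyX_linPoly (ξ : Module.Dual ℂ V) :
    polyX W B hB x α c (linPoly x ξ) = toH W B hB x α c (linX W x ξ) := by
  simp only [linPoly_eq_sum, linX, map_sum, map_smul, polyX_X, hX]

lemma polyY_linPoly (v : V) :
    polyY W B hB x α c (linPoly (yBasis B hB x) v) = toH W B hB x α c (linY W B hB x v) := by
  simp only [linPoly_eq_sum, linY, map_sum, map_smul, polyY_X, hY]

lemma hW_mul_polyX_linPoly (g : W) (ξ : Module.Dual ℂ V) :
    hW W B hB x α c g * polyX W B hB x α c (linPoly x ξ) =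
      polyX W B hB x α c (linPoly x (dualAct (g : V ≃ₗ[ℂ] V) ξ)) * hW W B hB x α c g := by
  have h := RingQuot.mkAlgHom_rel ℂ (Rel.w_x (B := B) (hB := hB) (x := x) (α := α) (c := c) g ξ)
  rw [map_mul, map_mul, ← polyX_linPoly, ← polyX_linPoly] at h
  change hW W B hB x α c g * _ * hW W B hB x α c g⁻¹ = _ at h
  rw [← h, mul_assoc _ _ (hW W B hB x α c g), ← map_mul, inv_mul_cancel, map_one, mul_one]

lemma hW_mul_polyY_linPoly (g : W) (v : V) :
    hW W B hB x α c g * polyY W B hB x α c (linPoly (yBasis B hB x) v) =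
      polyY W B hB x α c (linPoly (yBasis B hB x) ((g : V ≃ₗ[ℂ] V) v)) * hW W B hB x α c g := by
  have h := RingQuot.mkAlgHom_rel ℂ (Rel.w_y (B := B) (hB := hB) (x := x) (α := α) (c := c) g v)
  rw [map_mul, map_mul, ← polyY_linPoly, ← polyY_linPoly] at h
  change hW W B hB x α c g * _ * hW W B hB x α c g⁻¹ = _ at h
  rw [← h, mul_assoc _ _ (hW W B hB x α c g), ← map_mul, inv_mul_cancel, map_one, mul_one]

lemma hW_mul_polyX (g : W) (f : MvPolynomial (Fin n) ℂ) :
    hW W B hB x α c g * polyX W B hB x α c f =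
      polyX W B hB x α c (actX W x g f) * hW W B hB x α c g := by
  induction f using MvPolynomial.induction_on with
  | C a =>
    simp only [← MvPolynomial.algebraMap_eq, AlgHom.commutes]
    exact (Algebra.commutes _ _).symm
  | add p q hp hq => simp only [map_add, mul_add, add_mul, hp, hq]
  | mul_X p i hp =>
    rw [map_mul, ← mul_assoc, hp, mul_assoc, ← linPoly_basis x, hW_mul_polyX_linPoly, map_mul,
      map_mul, actX_linPoly, mul_assoc]

lemma hW_mul_polyY (g : W) (f : MvPolynomial (Fin n) ℂ) :
    hW W B hB x α c g * polyY W B hB x α c f =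
      polyY W B hB x α c (polyAct (yBasis B hB x) (g : V ≃ₗ[ℂ] V).toLinearMap f) *
        hW W B hB x α c g := by
  induction f using MvPolynomial.induction_on with
  | C a =>
    simp only [← MvPolynomial.algebraMap_eq, AlgHom.commutes]
    exact (Algebra.commutes _ _).symm
  | add p q hp hq => simp only [map_add, mul_add, add_mul, hp, hq]
  | mul_X p i hp =>
    rw [map_mul, ← mul_assoc, hp, mul_assoc, ← linPoly_basis (yBasis B hB x),
      hW_mul_polyY_linPoly, map_mul, map_mul, polyAct_linPoly, mul_assoc]
    rfl

lemma hY_mul_hX [Fintype (reflections W)] (i j : Fin n) :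
    hY W B hB x α c i * hX W B hB x α c j = hX W B hB x α c j * hY W B hB x α c i +
      ((if i = j then 1 else 0) + ∑ s : reflections W,
        (c s * (dualForm B hB (x i) (α s) * dualForm B hB (x j) (α s)) /
            dualForm B hB (α s) (α s)) • hW W B hB x α c (s : W)) := by
  have h := RingQuot.mkAlgHom_rel ℂ
    (Rel.y_x (W := W) (B := B) (hB := hB) (x := x) (α := α) (c := c) i j)
  rw [finsum_eq_sum_of_fintype, map_sub, map_mul, map_mul, map_add, map_sum,
    apply_ite (toH W B hB x α c), map_one, map_zero] at h
  simp only [map_smul] at h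
  exact sub_eq_iff_eq_add'.mp h

variable {W B hB x α c} in
lemma range_mulMap_le {P : Submodule ℂ (CherednikAlgebra W B hB x α c)}
    (h : ∀ f g w, polyX W B hB x α c f * polyY W B hB x α c g * hW W B hB x α c w ∈ P) :
    LinearMap.range (mulMap W B hB x α c) ≤ P := by
  rintro _ ⟨t, rfl⟩
  induction t using TensorProduct.induction_on with
  | zero => simp
  | add a b ha hb => rw [map_add]; exact add_mem ha hb
  | tmul a z =>
    induction a using TensorProduct.induction_on with
    | zero => simp
    | add a b ha hb => rw [TensorProduct.add_tmul, map_add]; exact add_mem ha hb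
    | tmul f g =>
      induction z using MonoidAlgebra.induction_on with
      | of w => rw [mulMap_tmul]; exact h f g w
      | add a b ha hb => rw [TensorProduct.tmul_add, map_add]; exact add_mem ha hb
      | smul r a ha => rw [TensorProduct.tmul_smul, map_smul]; exact P.smul_mem r ha

lemma mul_mem_range_mulMap (f g : MvPolynomial (Fin n) ℂ) (w : W) :
    polyX W B hB x α c f * polyY W B hB x α c g * hW W B hB x α c w ∈
      LinearMap.range (mulMap W B hB x α c) :=
  ⟨_, mulMap_tmul W B hB x α c f g w⟩

variable {W B hB x α c}

lemma hX_mul_mem_range {z : CherednikAlgebra W B hB x α c} (i : Fin n)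
    (hz : z ∈ LinearMap.range (mulMap W B hB x α c)) :
    hX W B hB x α c i * z ∈ LinearMap.range (mulMap W B hB x α c) := by
  refine range_mulMap_le (P := (LinearMap.range (mulMap W B hB x α c)).comap
    (LinearMap.mulLeft ℂ (hX W B hB x α c i))) (fun f g w => ?_) hz
  rw [Submodule.mem_comap, LinearMap.mulLeft_apply, ← mul_assoc, ← mul_assoc, ← polyX_X,
    ← map_mul]
  exact mul_mem_range_mulMap ..

lemma hW_mul_mem_range {z : CherednikAlgebra W B hB x α c} (v : W)
    (hz : z ∈ LinearMap.range (mulMap W B hB x α c)) :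
    hW W B hB x α c v * z ∈ LinearMap.range (mulMap W B hB x α c) := by
  refine range_mulMap_le (P := (LinearMap.range (mulMap W B hB x α c)).comap
    (LinearMap.mulLeft ℂ (hW W B hB x α c v))) (fun f g w => ?_) hz
  rw [Submodule.mem_comap, LinearMap.mulLeft_apply, ← mul_assoc, ← mul_assoc, hW_mul_polyX,
    mul_assoc _ (hW W B hB x α c v), hW_mul_polyY, mul_assoc, mul_assoc, ← map_mul, ← mul_assoc]
  exact mul_mem_range_mulMap ..

lemma hY_mul_mem_range [Finite W] {z : CherednikAlgebra W B hB x α c} (i : Fin n)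
    (hz : z ∈ LinearMap.range (mulMap W B hB x α c)) :
    hY W B hB x α c i * z ∈ LinearMap.range (mulMap W B hB x α c) := by
  let _ : Fintype (reflections W) := Fintype.ofFinite _
  refine range_mulMap_le (P := (LinearMap.range (mulMap W B hB x α c)).comap
    (LinearMap.mulLeft ℂ (hY W B hB x α c i))) (fun f g w => ?_) hz
  rw [Submodule.mem_comap, LinearMap.mulLeft_apply]
  induction f using MvPolynomial.induction_on with
  | C a =>
    rw [← MvPolynomial.algebraMap_eq, AlgHom.commutes, ← Algebra.smul_def, smul_mul_assoc,
      mul_smul_comm, ← mul_assoc, ← polyY_X, ← map_mul]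
    have := mul_mem_range_mulMap W B hB x α c 1 (MvPolynomial.X i * g) w
    rw [map_one, one_mul] at this
    exact Submodule.smul_mem _ _ this
  | add p q hp hq =>
    rw [map_add, add_mul, add_mul, mul_add]
    exact add_mem hp hq
  | mul_X p j hp =>
    rw [mul_comm p, map_mul, polyX_X, mul_assoc, mul_assoc, ← mul_assoc, hY_mul_hX,
      ← mul_assoc (polyX W B hB x α c p), add_mul, add_mul, mul_assoc, Finset.sum_mul]
    have hm := mul_mem_range_mulMap W B hB x α c p g w
    refine add_mem (hX_mul_mem_range j hp) (add_mem ?_ (sum_mem fun s _ => ?_))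
    · split_ifs
      · rwa [one_mul]
      · simp
    · rw [smul_mul_assoc]
      exact Submodule.smul_mem _ _ (hW_mul_mem_range _ hm)

/-- The relations move every generator past the polynomials in the `xᵢ` on its right, so the range
of `μ` is a left ideal. It contains `1`. -/
lemma mulMap_surjective [Finite W] : Function.Surjective (mulMap W B hB x α c) := by
  have key : ∀ a : FreeAlgebra ℂ (Gen n W), ∀ z ∈ LinearMap.range (mulMap W B hB x α c),
      toH W B hB x α c a * z ∈ LinearMap.range (mulMap W B hB x α c) := by
    intro a
    induction a using FreeAlgebra.induction with
    | grade0 r =>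
      intro z hz
      rw [AlgHom.commutes, ← Algebra.smul_def]
      exact Submodule.smul_mem _ _ hz
    | grade1 k =>
      intro z hz
      cases k with
      | x i => exact hX_mul_mem_range i hz
      | y i => exact hY_mul_mem_range i hz
      | w g => exact hW_mul_mem_range g hz
    | mul a b ha hb =>
      intro z hz
      rw [map_mul, mul_assoc]
      exact ha _ (hb z hz)
    | add a b ha hb =>
      intro z hz
      rw [map_add, add_mul]
      exact add_mem (ha z hz) (hb z hz)
  intro h
  obtain ⟨a, rfl⟩ := RingQuot.mkAlgHom_surjective ℂ (Rel W B hB x α c) h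
  have h1 := mul_mem_range_mulMap W B hB x α c 1 1 1
  rw [map_one, map_one, map_one, one_mul, one_mul] at h1
  simpa using key a 1 h1

end Spanning

/-! ### Representations of the Cherednik algebra -/

section Representation

variable {V : Type*} [AddCommGroup V] [Module ℂ V] [FiniteDimensional ℂ V] {n : ℕ}
  (W : Subgroup (V ≃ₗ[ℂ] V)) (B : LinearMap.BilinForm ℂ V)
  (hB : B.Nondegenerate) (x : Module.Basis (Fin n) ℂ (Module.Dual ℂ V))
  (α : reflections W → Module.Dual ℂ V) (c : reflections W → ℂ)

/-- The universal property of `H_c`. -/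
lemma exists_cherednik_lift [Fintype (reflections W)] {A : Type*} [Ring A] [Algebra ℂ A]
    (X : Module.Dual ℂ V →ₗ[ℂ] A) (Y : V →ₗ[ℂ] A) (G : W →* A)
    (hXX : ∀ ξ η, X ξ * X η = X η * X ξ) (hYY : ∀ u v, Y u * Y v = Y v * Y u)
    (hYX : ∀ i j, Y (yBasis B hB x i) * X (x j) = X (x j) * Y (yBasis B hB x i) +
      (if i = j then 1 else 0) + ∑ s : reflections W,
        (c s * (dualForm B hB (x i) (α s) * dualForm B hB (x j) (α s)) /
            dualForm B hB (α s) (α s)) • G (s : W))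
    (hGX : ∀ g ξ, G g * X ξ = X (dualAct (g : V ≃ₗ[ℂ] V) ξ) * G g)
    (hGY : ∀ g v, G g * Y v = Y ((g : V ≃ₗ[ℂ] V) v) * G g) :
    ∃ Φ : CherednikAlgebra W B hB x α c →ₐ[ℂ] A,
      (∀ i, Φ (hX W B hB x α c i) = X (x i)) ∧
      (∀ i, Φ (hY W B hB x α c i) = Y (yBasis B hB x i)) ∧
      ∀ g, Φ (hW W B hB x α c g) = G g := by
  let F : FreeAlgebra ℂ (Gen n W) →ₐ[ℂ] A := FreeAlgebra.lift ℂ fun k => match k with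
    | Gen.x i => X (x i)
    | Gen.y i => Y (yBasis B hB x i)
    | Gen.w g => G g
  have hFx : ∀ i, F (freeX n W i) = X (x i) := fun i => FreeAlgebra.lift_ι_apply _ _
  have hFy : ∀ i, F (freeY n W i) = Y (yBasis B hB x i) := fun i => FreeAlgebra.lift_ι_apply _ _
  have hFw : ∀ g, F (freeW n W g) = G g := fun g => FreeAlgebra.lift_ι_apply _ _
  have hFX : ∀ ξ, F (linX W x ξ) = X ξ := fun ξ => by
    simp only [linX, map_sum, map_smul, hFx]
    conv_rhs => rw [← x.sum_repr ξ, map_sum]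
    simp only [map_smul]
  have hFY : ∀ v, F (linY W B hB x v) = Y v := fun v => by
    simp only [linY, map_sum, map_smul, hFy]
    conv_rhs => rw [← (yBasis B hB x).sum_repr v, map_sum]
    simp only [map_smul]
  have hGG : ∀ g : W, G g * G g⁻¹ = 1 := fun g => by rw [← map_mul, mul_inv_cancel, map_one]
  have hF : ∀ ⦃a b⦄, Rel W B hB x α c a b → F a = F b := by
    intro a b hab
    induction hab with
    | x_comm i j => simp only [map_mul, hFx, hXX (x i)]
    | y_comm i j => simp only [map_mul, hFy, hYY (yBasis B hB x i)]
    | y_x i j =>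
      rw [finsum_eq_sum_of_fintype, map_sub, map_mul, map_mul, map_add, map_sum, apply_ite F,
        map_one, map_zero, hFx, hFy, hYX]
      simp only [map_smul, hFw]
      abel
    | w_x g ξ => rw [map_mul, map_mul, hFw, hFw, hFX, hFX, hGX, mul_assoc, hGG, mul_one]
    | w_y g v => rw [map_mul, map_mul, hFw, hFw, hFY, hFY, hGY, mul_assoc, hGG, mul_one]
    | w_mul g h => rw [map_mul, hFw, hFw, hFw, map_mul]
    | w_one => rw [hFw, map_one, map_one]
  refine ⟨RingQuot.liftAlgHom ℂ ⟨F, hF⟩, fun i => ?_, fun i => ?_, fun g => ?_⟩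
  · rw [hX, RingQuot.liftAlgHom_mkAlgHom_apply, hFx]
  · rw [hY, RingQuot.liftAlgHom_mkAlgHom_apply, hFy]
  · exact (RingQuot.liftAlgHom_mkAlgHom_apply ..).trans (hFw g)

/-- The action of `W` on the regular module `ℂ[V*] ⊗ ℂ[W]` of `ℂ[V*] ⋊ W`. -/
def regGroupOp : W →* Module.End ℂ (MvPolynomial (Fin n) ℂ ⊗[ℂ] MonoidAlgebra ℂ W) where
  toFun g := TensorProduct.map
    (polyAct (yBasis B hB x) (g : V ≃ₗ[ℂ] V).toLinearMap).toLinearMap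
    (LinearMap.mulLeft ℂ (MonoidAlgebra.of ℂ W g))
  map_one' := TensorProduct.ext' fun p z => by
    rw [TensorProduct.map_tmul, map_one, LinearMap.mulLeft_one]
    exact congrArg (· ⊗ₜ z) (AlgHom.congr_fun (polyAct_id (yBasis B hB x)) p)
  map_mul' g h := TensorProduct.ext' fun p z => by
    rw [Module.End.mul_apply, TensorProduct.map_tmul, TensorProduct.map_tmul,
      TensorProduct.map_tmul, map_mul, LinearMap.mulLeft_mul]
    exact congrArg (· ⊗ₜ _) (AlgHom.congr_fun (polyAct_comp (yBasis B hB x)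
      (g : V ≃ₗ[ℂ] V).toLinearMap (h : V ≃ₗ[ℂ] V).toLinearMap) p)

lemma regGroupOp_tmul (g : W) (p : MvPolynomial (Fin n) ℂ) (z : MonoidAlgebra ℂ W) :
    regGroupOp W B hB x g (p ⊗ₜ z) =
      polyAct (yBasis B hB x) (g : V ≃ₗ[ℂ] V).toLinearMap p ⊗ₜ (MonoidAlgebra.of ℂ W g * z) :=
  rfl

lemma regGroupOp_mul_mulOp (g : W) (v : V) :
    regGroupOp W B hB x g * mulOp _ (linPoly (yBasis B hB x) v) =
      mulOp _ (linPoly (yBasis B hB x) ((g : V ≃ₗ[ℂ] V) v)) * regGroupOp W B hB x g := by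
  refine TensorProduct.ext' fun p z => ?_
  rw [Module.End.mul_apply, Module.End.mul_apply, mulOp_tmul, regGroupOp_tmul, regGroupOp_tmul,
    mulOp_tmul, map_mul, polyAct_linPoly]
  rfl

end Representation

/-! ### Roots -/

section Roots

variable {V : Type*} [AddCommGroup V] [Module ℂ V] {W : Subgroup (V ≃ₗ[ℂ] V)}
  {α : reflections W → Module.Dual ℂ V} {a : reflections W → V}

lemma dualAct_reflection_apply (s : reflections W) (ξ : Module.Dual ℂ V) (v : V) :
    dualAct ((s : W) : V ≃ₗ[ℂ] V) ξ v = ξ (((s : W) : V ≃ₗ[ℂ] V) v) := by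
  have h : ((s : W) : V ≃ₗ[ℂ] V)⁻¹ = ((s : W) : V ≃ₗ[ℂ] V) := inv_eq_of_mul_eq_one_left s.2.1
  change ξ (((s : W) : V ≃ₗ[ℂ] V)⁻¹ v) = _
  rw [h]

lemma dualAct_reflection
    (ha : ∀ (s : reflections W) v, ((s : W) : V ≃ₗ[ℂ] V) v = v - α s v • a s)
    (s : reflections W) (ξ : Module.Dual ℂ V) :
    dualAct ((s : W) : V ≃ₗ[ℂ] V) ξ = ξ - ξ (a s) • α s := by
  ext v
  rw [dualAct_reflection_apply, ha]
  simp [mul_comm]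

/-- The functional `α_{gsg⁻¹} ∘ g` is anti-invariant under `s`, hence proportional to `αₛ`. -/
lemma root_conj_smul
    (hαs : ∀ (s : reflections W) (v : V), α s (((s : W) : V ≃ₗ[ℂ] V) v) = -α s v)
    (ha : ∀ (s : reflections W) v, ((s : W) : V ≃ₗ[ℂ] V) v = v - α s v • a s)
    (g : W) (s : reflections W) (v : V) :
    α (conjReflections W g s) ((g : V ≃ₗ[ℂ] V) v) • dualAct (g : V ≃ₗ[ℂ] V) (α s) =
      α s v • α (conjReflections W g s) := by
  set β : Module.Dual ℂ V :=
    α (conjReflections W g s) ∘ₗ (g : V ≃ₗ[ℂ] V).toLinearMap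
  have hβα : ∀ u, 2 * β u = α s u * β (a s) := by
    intro u
    have h1 : β (((s : W) : V ≃ₗ[ℂ] V) u) = -β u := by
      have h2 := hαs (conjReflections W g s) ((g : V ≃ₗ[ℂ] V) u)
      have h3 : (((conjReflections W g s : reflections W) : W) : V ≃ₗ[ℂ] V)
          ((g : V ≃ₗ[ℂ] V) u) = (g : V ≃ₗ[ℂ] V) (((s : W) : V ≃ₗ[ℂ] V) u) := by
        rw [← LinearEquiv.mul_apply, ← LinearEquiv.mul_apply]
        congr 1
        simp [conjReflections]
      rw [h3] at h2
      exact h2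
    rw [ha, map_sub, map_smul, smul_eq_mul] at h1
    linear_combination h1
  ext w
  obtain ⟨u, rfl⟩ := (g : V ≃ₗ[ℂ] V).surjective w
  have h4 : dualAct (g : V ≃ₗ[ℂ] V) (α s) ((g : V ≃ₗ[ℂ] V) u) = α s u :=
    congrArg (α s) ((g : V ≃ₗ[ℂ] V).symm_apply_apply u)
  rw [LinearMap.smul_apply, LinearMap.smul_apply, h4, smul_eq_mul, smul_eq_mul]
  change β v * α s u = α s v * β u
  linear_combination α s u / 2 * hβα v - α s v / 2 * hβα u

/-- The divided differences `f ↦ (f - s f) / αₛ`. -/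
lemma exists_dividedDifferences {n : ℕ} (x : Module.Basis (Fin n) ℂ (Module.Dual ℂ V))
    (hα : ∀ s, α s ≠ 0)
    (hξ : ∀ (s : reflections W) (ξ : Module.Dual ℂ V),
      dualAct ((s : W) : V ≃ₗ[ℂ] V) ξ = ξ - ξ (a s) • α s) :
    ∃ Δ : reflections W → MvPolynomial (Fin n) ℂ →ₗ[ℂ] MvPolynomial (Fin n) ℂ,
      ∀ s f, linPoly x (α s) * Δ s f = f - actX W x s f := by
  have h : ∀ s : reflections W, ∃ Δ : MvPolynomial (Fin n) ℂ →ₗ[ℂ] MvPolynomial (Fin n) ℂ,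
      ∀ f, linPoly x (α s) * Δ f = f - actX W x s f := fun s => by
    refine exists_dividedDifference (linPoly_ne_zero x (hα s)) _ fun i => ?_
    rw [← linPoly_basis x, actX_linPoly, ← map_sub, hξ, sub_sub_cancel, map_smul,
      MvPolynomial.smul_eq_C_mul]
    exact dvd_mul_left _ _
  choose Δ hΔ using h
  exact ⟨Δ, hΔ⟩

end Roots

/-! ### Injectivity of the multiplication map -/

section Injectivity

variable {V : Type*} [AddCommGroup V] [Module ℂ V] [FiniteDimensional ℂ V] {n : ℕ}
  {W : Subgroup (V ≃ₗ[ℂ] V)} {B : LinearMap.BilinForm ℂ V}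
  {hB : B.Nondegenerate} {x : Module.Basis (Fin n) ℂ (Module.Dual ℂ V)}
  {α : reflections W → Module.Dual ℂ V} {c : reflections W → ℂ}

/-- An action of `H_c` on `ℂ[V] ⊗ N`, with `N = ℂ[V*] ⊗ ℂ[W]`, in which the `xᵢ` act by
multiplication and in which the `yᵢ` and `w` act on `1 ⊗ N` through the regular module `N`, detects
all elements of `ℂ[V] ⊗ ℂ[V*] ⊗ ℂ[W]`. -/
lemma mulMap_injective_of_action
    (Φ : CherednikAlgebra W B hB x α c →ₐ[ℂ] Module.End ℂ (MvPolynomial (Fin n) ℂ ⊗[ℂ]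
      (MvPolynomial (Fin n) ℂ ⊗[ℂ] MonoidAlgebra ℂ W)))
    (hΦX : ∀ i, Φ (hX W B hB x α c i) = mulOp _ (MvPolynomial.X i))
    (hΦY : ∀ i m, Φ (hY W B hB x α c i) (1 ⊗ₜ m) = 1 ⊗ₜ mulOp _ (MvPolynomial.X i) m)
    (hΦW : ∀ g, Φ (hW W B hB x α c g) (1 ⊗ₜ (1 ⊗ₜ 1)) = 1 ⊗ₜ (1 ⊗ₜ MonoidAlgebra.of ℂ W g)) :
    Function.Injective (mulMap W B hB x α c) := by
  have hpX : ∀ f, Φ (polyX W B hB x α c f) = mulOp _ f := by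
    intro f
    have : Φ.comp (polyX W B hB x α c) = mulOp _ :=
      MvPolynomial.algHom_ext fun i => by rw [AlgHom.comp_apply, polyX_X, hΦX]
    exact AlgHom.congr_fun this f
  have hpY : ∀ g m, Φ (polyY W B hB x α c g) (1 ⊗ₜ m) = 1 ⊗ₜ mulOp _ g m := by
    intro g
    induction g using MvPolynomial.induction_on with
    | C r =>
      intro m
      rw [← MvPolynomial.algebraMap_eq, AlgHom.commutes, AlgHom.commutes, AlgHom.commutes,
        Module.algebraMap_end_apply, Module.algebraMap_end_apply, TensorProduct.tmul_smul]
    | add p q hp hq =>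
      intro m
      rw [map_add, map_add, map_add, LinearMap.add_apply, LinearMap.add_apply, hp, hq,
        TensorProduct.tmul_add]
    | mul_X p i hp =>
      intro m
      rw [map_mul, map_mul, map_mul, Module.End.mul_apply, Module.End.mul_apply, polyY_X, hΦY, hp]
  let ev : CherednikAlgebra W B hB x α c →ₗ[ℂ] MvPolynomial (Fin n) ℂ ⊗[ℂ]
      (MvPolynomial (Fin n) ℂ ⊗[ℂ] MonoidAlgebra ℂ W) :=
    LinearMap.applyₗ (1 ⊗ₜ (1 ⊗ₜ 1)) ∘ₗ Φ.toLinearMap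
  have hev : ev ∘ₗ mulMap W B hB x α c = (TensorProduct.assoc ℂ _ _ _).toLinearMap := by
    refine TensorProduct.ext_threefold fun f g z => ?_
    induction z using MonoidAlgebra.induction_on with
    | of w =>
      rw [LinearMap.comp_apply, mulMap_tmul]
      change Φ _ _ = _
      rw [map_mul, map_mul, Module.End.mul_apply, Module.End.mul_apply, hΦW, hpY, hpX, mulOp_tmul,
        mulOp_tmul, mul_one, mul_one]
      rfl
    | add a b ha hb => rw [TensorProduct.tmul_add, map_add, map_add, ha, hb]
    | smul r a ha => rw [TensorProduct.tmul_smul, map_smul, map_smul, ha]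
  have hinj : Function.Injective (ev ∘ₗ mulMap W B hB x α c) := by
    rw [hev]
    exact (TensorProduct.assoc ℂ _ _ _).injective
  exact Function.Injective.of_comp (f := ev) hinj

/-- The Dunkl operators with coefficients in `ℂ[V*] ⊗ ℂ[W]` satisfy the relations of `H_c`. The action
of `H_c` so obtained takes `f(x) g(y) w` and the vector `1 ⊗ 1 ⊗ 1` to `f ⊗ g ⊗ w`. -/
lemma mulMap_injective [Finite W] (hBsymm : B.IsSymm)
    (hBinv : ∀ w ∈ W, ∀ u v : V, B (w u) (w v) = B u v)
    (hα : ∀ s, α s ≠ 0)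
    (hαs : ∀ (s : reflections W) (v : V), α s (((s : W) : V ≃ₗ[ℂ] V) v) = -α s v)
    (hc : ∀ (w : W) (s t : reflections W), (t : W) = w * (s : W) * w⁻¹ → c t = c s)
    (hx : ∀ i j, dualForm B hB (x i) (x j) = if i = j then 1 else 0) :
    Function.Injective (mulMap W B hB x α c) := by
  let _ : Fintype (reflections W) := Fintype.ofFinite _
  have hBdual : ∀ ξ v, B ((B.toDual hB).symm ξ) v = ξ v := fun ξ v => by
    rw [← LinearMap.BilinForm.toDual_def hB, LinearEquiv.apply_symm_apply]
  have hdual : ∀ ξ η, dualForm B hB ξ η = ξ ((B.toDual hB).symm η) := fun ξ η => hBdual _ _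
  let b : reflections W → V := fun s => (B.toDual hB).symm (α s)
  have hrefl := fun s : reflections W =>
    IsReflection.apply_eq s.2 B hB (hBinv _ (s : W).2) (hα s) (hαs s)
  have hb0 : ∀ s, α s (b s) ≠ 0 := fun s => (hrefl s).1
  let a : reflections W → V := fun s => (2 / α s (b s)) • b s
  have ha : ∀ (s : reflections W) v, ((s : W) : V ≃ₗ[ℂ] V) v = v - α s v • a s := fun s v => by
    rw [(hrefl s).2 v, smul_smul]
    congr 2
    ring
  have hξ := dualAct_reflection ha
  obtain ⟨Δ, hΔ⟩ := exists_dividedDifferences x hα hξ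
  have hprop := root_conj_smul hαs ha
  -- The factor `1/2` compensates for the `2` in the formula for the reflection `s`.
  let κ : reflections W → ℂ := fun s => c s / 2
  have hκ : ∀ (g : W) s, κ (conjReflections W g s) = κ s := fun g s => by
    simp only [κ, hc g s (conjReflections W g s) rfl]
  let Y : V →ₗ[ℂ] Module.End ℂ (MvPolynomial (Fin n) ℂ ⊗[ℂ] MonoidAlgebra ℂ W) :=
    (mulOp (MonoidAlgebra ℂ W)).toLinearMap ∘ₗ linPoly (yBasis B hB x)
  have hYY : ∀ u v, Y u * Y v = Y v * Y u := fun u v => by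
    change mulOp _ _ * mulOp _ _ = mulOp _ _ * mulOp _ _
    rw [← map_mul, mul_comm, map_mul]
  let τ := regGroupOp W B hB x
  have hτY : ∀ (g : W) (v : V), τ g * Y v = Y ((g : V ≃ₗ[ℂ] V) v) * τ g :=
    regGroupOp_mul_mulOp W B hB x
  let D : V →ₗ[ℂ] Module.End ℂ (MvPolynomial (Fin n) ℂ ⊗[ℂ]
      (MvPolynomial (Fin n) ℂ ⊗[ℂ] MonoidAlgebra ℂ W)) :=
    { toFun := dunkl x α Δ τ κ Y
      map_add' := dunkl_add x α Δ τ κ Y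
      map_smul' := dunkl_smul x α Δ τ κ Y }
  let X : Module.Dual ℂ V →ₗ[ℂ] Module.End ℂ (MvPolynomial (Fin n) ℂ ⊗[ℂ]
      (MvPolynomial (Fin n) ℂ ⊗[ℂ] MonoidAlgebra ℂ W)) :=
    (mulOp (MvPolynomial (Fin n) ℂ ⊗[ℂ] MonoidAlgebra ℂ W)).toLinearMap ∘ₗ linPoly x
  have hXX : ∀ ξ η, X ξ * X η = X η * X ξ := fun ξ η => by
    change mulOp _ _ * mulOp _ _ = mulOp _ _ * mulOp _ _
    rw [← map_mul, mul_comm, map_mul]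
  have hGX : ∀ g ξ, groupOp x τ g * X ξ =
      X (dualAct (g : V ≃ₗ[ℂ] V) ξ) * groupOp x τ g := fun g ξ =>
    TensorProduct.ext' fun f m => by
      change groupOp x τ g (mulOp _ (linPoly x ξ) (f ⊗ₜ m)) =
        mulOp _ (linPoly x (dualAct (g : V ≃ₗ[ℂ] V) ξ)) (groupOp x τ g (f ⊗ₜ m))
      rw [mulOp_tmul, groupOp_tmul, groupOp_tmul, mulOp_tmul, map_mul, actX_linPoly]
  have hDX : ∀ i j, D (yBasis B hB x i) * X (x j) = X (x j) * D (yBasis B hB x i) +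
      (if i = j then 1 else 0) + ∑ s : reflections W,
        (c s * (dualForm B hB (x i) (α s) * dualForm B hB (x j) (α s)) /
            dualForm B hB (α s) (α s)) • groupOp x τ (s : W) := fun i j => by
    refine (dunkl_mul_mulOp x hα hΔ _ _ (fun s => x j (a s)) fun s => hξ s _).trans ?_
    congr 1
    · congr 1
      rw [show x j (yBasis B hB x i) = if i = j then 1 else 0 by
        rw [yBasis, Module.Basis.map_apply, ← hdual, hx]
        simp only [eq_comm]]
      split_ifs <;> simp
    · refine Finset.sum_congr rfl fun s _ => ?_
      congr 1
      have h1 : α s (yBasis B hB x i) = x i (b s) := by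
        rw [yBasis, Module.Basis.map_apply, ← hBdual, hBsymm.eq, hBdual]
      rw [h1, hdual, hdual, hdual]
      change c s / 2 * x i (b s) * x j ((2 / α s (b s)) • b s) =
        c s * (x i (b s) * x j (b s)) / α s (b s)
      rw [map_smul, smul_eq_mul]
      have := hb0 s
      field_simp
  have hDD : ∀ u v, D u * D v = D v * D u :=
    dunkl_commute x hα hΔ hτY hYY hκ hprop a ha hξ
  have hGD : ∀ (g : W) (v : V),
      groupOp x τ g * D v = D ((g : V ≃ₗ[ℂ] V) v) * groupOp x τ g :=
    groupOp_mul_dunkl x hα hΔ hτY hκ hprop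
  obtain ⟨Φ, hΦX, hΦY, hΦW⟩ :=
    exists_cherednik_lift (A := Module.End ℂ (MvPolynomial (Fin n) ℂ ⊗[ℂ]
      (MvPolynomial (Fin n) ℂ ⊗[ℂ] MonoidAlgebra ℂ W))) W B hB x α c X D
      (groupOp x τ) hXX hDD hDX hGX hGD
  refine mulMap_injective_of_action Φ (fun i => ?_) (fun i m => ?_) fun g => ?_
  · rw [hΦX, ← linPoly_basis x]
    rfl
  · rw [hΦY, ← linPoly_basis (yBasis B hB x)]
    exact dunkl_one_tmul x hα hΔ _ m
  · rw [hΦW, groupOp_tmul, regGroupOp_tmul, map_one, map_one, mul_one]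

end Injectivity

end RationalCherednik

end

theorem mainTheorem8 {V : Type*} [AddCommGroup V] [Module ℂ V] [FiniteDimensional ℂ V]
    (W : Subgroup (V ≃ₗ[ℂ] V)) [Finite W]
    (hW : Subgroup.closure (RationalCherednik.reflections W) = ⊤)
    (B : LinearMap.BilinForm ℂ V) (hB : B.Nondegenerate) (hBsymm : B.IsSymm)
    (hBinv : ∀ w ∈ W, ∀ u v : V, B (w u) (w v) = B u v)
    (α : RationalCherednik.reflections W → Module.Dual ℂ V)
    (hα : ∀ s, α s ≠ 0)
    (hαs : ∀ (s : RationalCherednik.reflections W) (v : V),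
      α s (((s : W) : V ≃ₗ[ℂ] V) v) = -α s v)
    (c : RationalCherednik.reflections W → ℂ)
    (hc : ∀ (w : W) (s t : RationalCherednik.reflections W),
      (t : W) = w * (s : W) * w⁻¹ → c t = c s)
    {n : ℕ} (x : Module.Basis (Fin n) ℂ (Module.Dual ℂ V))
    (hx : ∀ i j, RationalCherednik.dualForm B hB (x i) (x j) = if i = j then 1 else 0) :
    Function.Bijective (RationalCherednik.mulMap W B hB x α c) := by
  exact ⟨RationalCherednik.mulMap_injective hBsymm hBinv hα hαs hc hx,
    RationalCherednik.mulMap_surjective⟩
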